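/- **Setting.** Let $E\subset\mathbb R^m$ be a closed, convex, pointed cone with non-empty interior, and write $u\preceq_E w$ iff $w-u\in E$. Let $E^*=\{v:\langle v,z\rangle\ge 0\ \forall z\in E\}$ and let $V\subset E^*\setminus\{0\}$ be a compact set with $\operatorname{cone}(\operatorname{co}(V))=E^*$. Let $\Phi:\mathbb R^n\to\mathbb R^m$ be continuously differentiable with Jacobian $J\Phi$, and put $$\lambda(u,d)=\sup_{v\in V}\langle J\Phi(u)d,v\rangle,\qquad \vartheta(u)=\operatorname*{arg\,min}_{d\in\mathbb R^n}\Big(\lambda(u,d)+\tfrac12\|d\|^2\Big)$$ (the minimizer exists and is unique). Fix $0<\rho<\sigma<1$, $\mu>0$ and $\xi\in E$ with $0<\langle\xi,v\rangle\le1$ for all $v\in V$. **Algorithm TT-PRP.** Start from $x^0\in\mathbb R^n$; stop at $x^k$ if $\vartheta(x^k)=0$. Put $d^0=\vartheta(x^0)$. For $k\ge1$ choose any $\alpha_{k-1}>0$ such that, with $x^k=x^{k-1}+\alpha_{k-1}d^{k-1}$, the generalized Wolfe conditions $$\Phi(x^k)\preceq_E\Phi(x^{k-1})+\rho\,\alpha_{k-1}\lambda(x^{k-1},d^{k-1})\,\xi,\qquad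 -\mu\lambda(x^{k-1},d^{k-1})\ge\lambda(x^k,d^{k-1})\ge\sigma\lambda(x^{k-1},d^{k-1})$$ hold, and (if $\vartheta(x^k)\ne0$) put $$d^k=\vartheta(x^k)+\beta_kd^{k-1}-\beta_k\frac{|\lambda(x^k,d^{k-1})|}{\lambda(x^k,\vartheta(x^k))}\vartheta(x^k),\qquad \beta_k=\max\Big\{0,\frac{-\lambda(x^k,\vartheta(x^k))+\lambda(x^{k-1},\vartheta(x^k))}{-\lambda(x^{k-1},\vartheta(x^{k-1}))}\Big\}.$$ **Theorem 4.1.** Assume that $V$ is finite, that $\Delta=\{x\in\mathbb R^n:\Phi(x)\preceq_E\Phi(x^0)\}$ is bounded, and that $J\Phi$ is $L$-Lipschitz continuous, for some $L\ge 0$, on an open set $\Omega\supset\Delta$. If Algorithm TT-PRP generates an infinite sequence $\{x^k\}$ (that is, it never stops, so $\vartheta(x^k)\ne0$ for all $k\ge0$), then $$\liminf_{k\to\infty}\|\vartheta(x^k)\|=0.$$ -/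

import Mathlib

open Filter Set
open scoped RealInnerProductSpace NNReal

namespace VecOpt

/-- `u ≼_E w`, i.e. `w - u ∈ E`. -/
def coneLE {m : ℕ} (E : ProperCone ℝ (EuclideanSpace ℝ (Fin m)))
    (u w : EuclideanSpace ℝ (Fin m)) : Prop :=
  w - u ∈ E

/-- `E` (closed and convex, and containing `0`, as a `ProperCone`) is pointed,
i.e. `E ∩ (-E) = {0}`, and has non-empty interior. -/
structure IsOrderingCone {m : ℕ} (E : ProperCone ℝ (EuclideanSpace ℝ (Fin m))) : Prop where
  pointed : ∀ y ∈ E, -y ∈ E → y = 0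
  interior_nonempty : (interior (E : Set (EuclideanSpace ℝ (Fin m)))).Nonempty

/-- `V` is a compact subset of `E* \ {0}` with `cone (co V) = E*`. -/
structure IsDualBase {m : ℕ} (E : ProperCone ℝ (EuclideanSpace ℝ (Fin m)))
    (V : Set (EuclideanSpace ℝ (Fin m))) : Prop where
  isCompact : IsCompact V
  subset_dual : V ⊆ (ProperCone.innerDual (E : Set (EuclideanSpace ℝ (Fin m))) :
    Set (EuclideanSpace ℝ (Fin m)))
  zero_notMem : (0 : EuclideanSpace ℝ (Fin m)) ∉ V
  cone_hull : (PointedCone.hull ℝ (convexHull ℝ V) : Set (EuclideanSpace ℝ (Fin m))) =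
    ProperCone.innerDual (E : Set (EuclideanSpace ℝ (Fin m)))

/-- `λ(u,d) = sup {⟨JΦ(u) d, v⟩ : v ∈ V}`. -/
noncomputable def lam {n m : ℕ} (V : Set (EuclideanSpace ℝ (Fin m)))
    (Φ : EuclideanSpace ℝ (Fin n) → EuclideanSpace ℝ (Fin m))
    (u d : EuclideanSpace ℝ (Fin n)) : ℝ :=
  sSup ((fun v => ⟪fderiv ℝ Φ u d, v⟫) '' V)

/-- `d` is a minimizer over `ℝⁿ` of `λ(u,·) + ‖·‖²/2`. -/
def IsSteepest {n m : ℕ} (V : Set (EuclideanSpace ℝ (Fin m)))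
    (Φ : EuclideanSpace ℝ (Fin n) → EuclideanSpace ℝ (Fin m))
    (u d : EuclideanSpace ℝ (Fin n)) : Prop :=
  ∀ e : EuclideanSpace ℝ (Fin n), lam V Φ u d + ‖d‖ ^ 2 / 2 ≤ lam V Φ u e + ‖e‖ ^ 2 / 2

/-- The steepest direction `ϑ(u) = argmin_d λ(u,d) + ‖d‖²/2`. The minimizer exists and is unique
for compact `V`: see `isSteepest_steepest` and `IsSteepest.eq_steepest`. -/
noncomputable def steepest {n m : ℕ} (V : Set (EuclideanSpace ℝ (Fin m)))
    (Φ : EuclideanSpace ℝ (Fin n) → EuclideanSpace ℝ (Fin m))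
    (u : EuclideanSpace ℝ (Fin n)) : EuclideanSpace ℝ (Fin n) :=
  Classical.epsilon (IsSteepest V Φ u)

theorem lam_le_add {n m : ℕ} {V : Set (EuclideanSpace ℝ (Fin m))} (hV : IsCompact V)
    (Φ : EuclideanSpace ℝ (Fin n) → EuclideanSpace ℝ (Fin m))
    (u : EuclideanSpace ℝ (Fin n)) :
    ∃ C : ℝ, 0 ≤ C ∧ ∀ d e, lam V Φ u d ≤ lam V Φ u e + C * ‖d - e‖ := by
  obtain ⟨R, hR⟩ := hV.isBounded.exists_norm_le
  have hbdd : ∀ d, BddAbove ((fun v => ⟪fderiv ℝ Φ u d, v⟫) '' V) := fun d =>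
    (hV.image (by fun_prop)).bddAbove
  rcases V.eq_empty_or_nonempty with rfl | hne
  · exact ⟨0, le_rfl, fun d e => by simp [lam]⟩
  have hR0 : 0 ≤ R := (norm_nonneg _).trans (hR _ hne.some_mem)
  refine ⟨‖fderiv ℝ Φ u‖ * R, by positivity, fun d e => ?_⟩
  refine csSup_le (hne.image _) ?_
  rintro _ ⟨v, hv, rfl⟩
  have h1 : ⟪fderiv ℝ Φ u e, v⟫ ≤ lam V Φ u e := le_csSup (hbdd e) ⟨v, hv, rfl⟩
  have h2 : ⟪fderiv ℝ Φ u (d - e), v⟫ ≤ ‖fderiv ℝ Φ u‖ * R * ‖d - e‖ := by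
    calc ⟪fderiv ℝ Φ u (d - e), v⟫ ≤ ‖fderiv ℝ Φ u (d - e)‖ * ‖v‖ := real_inner_le_norm _ _
      _ ≤ (‖fderiv ℝ Φ u‖ * ‖d - e‖) * R := by
        gcongr
        · exact (fderiv ℝ Φ u).le_opNorm _
        · exact hR v hv
      _ = _ := by ring
  have h3 : ⟪fderiv ℝ Φ u d, v⟫ = ⟪fderiv ℝ Φ u e, v⟫ + ⟪fderiv ℝ Φ u (d - e), v⟫ := by
    rw [← inner_add_left, map_sub, add_sub_cancel]
  simp only [h3]
  linarith

theorem isSteepest_steepest {n m : ℕ} {V : Set (EuclideanSpace ℝ (Fin m))} (hV : IsCompact V)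
    (Φ : EuclideanSpace ℝ (Fin n) → EuclideanSpace ℝ (Fin m))
    (u : EuclideanSpace ℝ (Fin n)) : IsSteepest V Φ u (steepest V Φ u) := by
  refine Classical.epsilon_spec (p := IsSteepest V Φ u) ?_
  obtain ⟨C, hC0, hC⟩ := lam_le_add hV Φ u
  have hcont : Continuous (lam V Φ u) := by
    have : LipschitzWith ⟨C, hC0⟩ (lam V Φ u) := by
      refine LipschitzWith.of_le_add_mul _ fun d e => ?_
      rw [dist_eq_norm]
      exact hC d e
    exact this.continuous
  have hg : Continuous fun d => lam V Φ u d + ‖d‖ ^ 2 / 2 := by fun_prop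
  have hzero : lam V Φ u 0 = 0 := by
    rcases V.eq_empty_or_nonempty with rfl | hne
    · simp [lam]
    · simp [lam, hne.image_const]
  refine hg.exists_forall_le' 0 ?_
  have hcoe : ∀ᶠ d : EuclideanSpace ℝ (Fin n) in cocompact _, 2 * C ≤ ‖d‖ :=
    (tendsto_norm_cocompact_atTop).eventually_ge_atTop _
  filter_upwards [hcoe] with d hd
  have h := hC 0 d
  rw [hzero, zero_sub, norm_neg] at h
  rw [hzero, norm_zero]
  nlinarith [norm_nonneg d]

theorem IsSteepest.eq_steepest {n m : ℕ} {V : Set (EuclideanSpace ℝ (Fin m))} (hV : IsCompact V)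
    {Φ : EuclideanSpace ℝ (Fin n) → EuclideanSpace ℝ (Fin m)}
    {u d : EuclideanSpace ℝ (Fin n)} (hd : IsSteepest V Φ u d) : d = steepest V Φ u := by
  have he := isSteepest_steepest hV Φ u
  set e := steepest V Φ u
  have hmid : lam V Φ u ((1 / 2 : ℝ) • (d + e)) ≤ (lam V Φ u d + lam V Φ u e) / 2 := by
    rcases V.eq_empty_or_nonempty with rfl | hne
    · simp [lam]
    have hbdd : ∀ d, BddAbove ((fun v => ⟪fderiv ℝ Φ u d, v⟫) '' V) := fun d =>
      (hV.image (by fun_prop)).bddAbove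
    refine csSup_le (hne.image _) ?_
    rintro _ ⟨v, hv, rfl⟩
    have h1 : ⟪fderiv ℝ Φ u d, v⟫ ≤ lam V Φ u d := le_csSup (hbdd d) ⟨v, hv, rfl⟩
    have h2 : ⟪fderiv ℝ Φ u e, v⟫ ≤ lam V Φ u e := le_csSup (hbdd e) ⟨v, hv, rfl⟩
    simp only [map_smul, map_add, real_inner_smul_left, inner_add_left]
    linarith
  have h1 := hd ((1 / 2 : ℝ) • (d + e))
  have h2 := he ((1 / 2 : ℝ) • (d + e))
  have hp := parallelogram_law_with_norm ℝ d e
  have hn : ‖(1 / 2 : ℝ) • (d + e)‖ ^ 2 = ‖d + e‖ ^ 2 / 4 := by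
    rw [norm_smul, mul_pow]; norm_num; ring
  rw [hn] at h1 h2
  have h0 : ‖d - e‖ * ‖d - e‖ ≤ 0 := by nlinarith
  have h00 : ‖d - e‖ = 0 := by nlinarith [norm_nonneg (d - e)]
  exact sub_eq_zero.mp (norm_eq_zero.mp h00)

/-- The truncated PRP parameter for the consecutive iterates `y` (old) and `x` (new). -/
noncomputable def prpPlus {n m : ℕ} (V : Set (EuclideanSpace ℝ (Fin m)))
    (Φ : EuclideanSpace ℝ (Fin n) → EuclideanSpace ℝ (Fin m))
    (y x : EuclideanSpace ℝ (Fin n)) : ℝ :=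
  max 0 ((-lam V Φ x (steepest V Φ x) + lam V Φ y (steepest V Φ x)) /
    (-lam V Φ y (steepest V Φ y)))

/-- The generalized Wolfe conditions for the step `κ > 0` from `u` along `d`. -/
structure GeneralizedWolfe {n m : ℕ} (E : ProperCone ℝ (EuclideanSpace ℝ (Fin m)))
    (V : Set (EuclideanSpace ℝ (Fin m)))
    (Φ : EuclideanSpace ℝ (Fin n) → EuclideanSpace ℝ (Fin m))
    (ρ σ μ : ℝ) (ξ : EuclideanSpace ℝ (Fin m))
    (u d : EuclideanSpace ℝ (Fin n)) (κ : ℝ) : Prop where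
  step_pos : 0 < κ
  decrease : coneLE E (Φ (u + κ • d)) (Φ u + (ρ * κ * lam V Φ u d) • ξ)
  curvature_upper : lam V Φ (u + κ • d) d ≤ -μ * lam V Φ u d
  curvature_lower : σ * lam V Φ u d ≤ lam V Φ (u + κ • d) d

/-- `x`, `d`, `α` are the iterates, search directions and step sizes of a run of
Algorithm TT-PRP (with parameters `ρ, σ, μ, ξ`) that never stops. -/
structure IsInfiniteRun {n m : ℕ} (E : ProperCone ℝ (EuclideanSpace ℝ (Fin m)))
    (V : Set (EuclideanSpace ℝ (Fin m)))
    (Φ : EuclideanSpace ℝ (Fin n) → EuclideanSpace ℝ (Fin m))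
    (ρ σ μ : ℝ) (ξ : EuclideanSpace ℝ (Fin m))
    (x d : ℕ → EuclideanSpace ℝ (Fin n)) (α : ℕ → ℝ) : Prop where
  no_stop : ∀ k, steepest V Φ (x k) ≠ 0
  dir_zero : d 0 = steepest V Φ (x 0)
  line_search : ∀ k, GeneralizedWolfe E V Φ ρ σ μ ξ (x k) (d k) (α k)
  step : ∀ k, x (k + 1) = x k + α k • d k
  dir_succ : ∀ k, d (k + 1) = steepest V Φ (x (k + 1))
    + prpPlus V Φ (x k) (x (k + 1)) • d k
    - (prpPlus V Φ (x k) (x (k + 1)) *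
        (|lam V Φ (x (k + 1)) (d k)| / lam V Φ (x (k + 1)) (steepest V Φ (x (k + 1))))) •
      steepest V Φ (x (k + 1))

end VecOpt

namespace VecOpt

/-! ### Real sequences and the geometry of conjugate gradient directions -/

section Sequences

/-! Suppose `‖ϑ(x k)‖ ≥ γ > 0` eventually. The scheme gives sufficient descent, `λ(x k, d k) ≤ -‖ϑ(x
k)‖²` (`IsInfiniteRun.lam_le`), and the Wolfe conditions force `-λ(x k, d k) / ‖d k‖ → 0`
(`IsInfiniteRun.tendsto_slope`). Hence `‖d k‖ → ∞`.

This is impossible by a Gilbert–Nocedal argument (`not_tendsto_norm_direction_atTop`). Write `d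
(k+1) = r k + β k • d k`, where `r k` is a multiple of the steepest direction. The PRP parameter is
`O(‖x (k+1) - x k‖)`, and `‖r k‖` is bounded up to a vanishing multiple of `β k * ‖d k‖`. If `‖d k‖
→ ∞`, then `‖r k‖ / ‖d (k+1)‖ → 0`, so consecutive unit directions merge. Over a window of `N` late
steps the path is then nearly straight, and its length is at most twice the diameter of the level
set, whatever `N` is. The `N` factors `β` thus have bounded sum, so their product is small for large
`N`. This gives `‖d (k+N)‖ ≤ const + ‖d k‖ / 2` for all large `k`, against divergence. -/

theorem le_geom_sum_add_prod {a b : ℕ → ℝ} {G B : ℝ} (hG : 0 ≤ G)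
    (hb : ∀ i, 0 ≤ b i) {N : ℕ} (hB : ∀ i < N, b i ≤ B)
    (hab : ∀ i < N, a (i + 1) ≤ G + b i * a i) :
    a N ≤ G * ∑ l ∈ Finset.range N, B ^ l + (∏ i ∈ Finset.range N, b i) * a 0 := by
  induction N with
  | zero => simp
  | succ j ih =>
    have h := ih (fun i hi => hB i (by omega)) (fun i hi => hab i (by omega))
    have hBj := hB j (by omega)
    have hB0 : 0 ≤ B := (hb j).trans hBj
    have hS : 0 ≤ G * ∑ l ∈ Finset.range j, B ^ l :=
      mul_nonneg hG (Finset.sum_nonneg fun l _ => pow_nonneg hB0 l)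
    have h1 := hab j (by omega)
    have h2 := mul_le_mul_of_nonneg_left h (hb j)
    have h3 := mul_le_mul_of_nonneg_right hBj hS
    have h4 : ∑ l ∈ Finset.range (j + 1), B ^ l = B * ∑ l ∈ Finset.range j, B ^ l + 1 := by
      rw [Finset.sum_range_succ', Finset.mul_sum]
      simp [pow_succ']
    rw [Finset.prod_range_succ, h4]
    nlinarith

/-- Apply `b ≤ exp (b - 1)` to each factor. If the sum stays bounded as `N` grows, the product
decays exponentially. -/
theorem prod_le_exp_sum_sub_card {b : ℕ → ℝ} (hb : ∀ i, 0 ≤ b i) (N : ℕ) :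
    ∏ i ∈ Finset.range N, b i ≤ Real.exp (∑ i ∈ Finset.range N, b i - N) := by
  calc ∏ i ∈ Finset.range N, b i ≤ ∏ i ∈ Finset.range N, Real.exp (b i - 1) := by
        refine Finset.prod_le_prod (fun i _ => hb i) fun i _ => ?_
        linarith [Real.add_one_le_exp (b i - 1)]
    _ = _ := by
        rw [← Real.exp_sum, Finset.sum_sub_distrib]
        simp

theorem not_tendsto_atTop_of_le_half {a : ℕ → ℝ} {C : ℝ} {N K : ℕ} (hN : 0 < N)
    (h : ∀ k ≥ K, a (k + N) ≤ C + a k / 2) : ¬ Tendsto a atTop atTop := by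
  intro ha
  -- This bound is preserved by `t ↦ C + t / 2`, so the progression `K + j * N` already carries a
  -- bounded subsequence.
  set M : ℝ := max (2 * C) (a K)
  have hM : ∀ j, a (K + j * N) ≤ M := by
    intro j
    induction j with
    | zero => simp [M]
    | succ j ih =>
      have h1 := h (K + j * N) (by omega)
      have h2 : 2 * C ≤ M := le_max_left _ _
      rw [show K + (j + 1) * N = K + j * N + N by ring]
      linarith
  have hsub : Tendsto (fun j => K + j * N) atTop atTop := by
    refine tendsto_atTop_mono (f := fun j => j) (fun j => ?_) tendsto_id
    show j ≤ K + j * N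
    nlinarith
  obtain ⟨j, hj⟩ := ((ha.comp hsub).eventually_gt_atTop M).exists
  exact absurd (hM j) (not_le.mpr hj)

theorem tendsto_sub_succ_of_le {φ : ℕ → ℝ} (hφ : Antitone φ) {c : ℝ} (hc : ∀ k, c ≤ φ k) :
    Tendsto (fun k => φ k - φ (k + 1)) atTop (nhds 0) := by
  have h := tendsto_atTop_ciInf hφ ⟨c, by rintro _ ⟨k, rfl⟩; exact hc k⟩
  simpa using h.sub (h.comp (tendsto_add_atTop_nat 1))

variable {F : Type*} [NormedAddCommGroup F]

theorem eventually_norm_window_le_one {u : ℕ → F}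
    (hu : Tendsto (fun k => ‖u (k + 1) - u k‖) atTop (nhds 0)) (N : ℕ) :
    ∀ᶠ k in atTop, ∀ i < N, ‖u (k + i) - u k‖ ≤ 1 := by
  have key : ∀ i, Tendsto (fun k => ‖u (k + i) - u k‖) atTop (nhds 0) := by
    intro i
    induction i with
    | zero => simp
    | succ i ih =>
      have h1 : Tendsto (fun k => ‖u (k + i + 1) - u (k + i)‖) atTop (nhds 0) :=
        hu.comp (tendsto_add_atTop_nat i)
      have h2 := h1.add ih
      rw [add_zero] at h2
      exact squeeze_zero (fun _ => norm_nonneg _)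
        (fun k => norm_sub_le_norm_sub_add_norm_sub _ _ _) h2
  have h := (Set.finite_Iio N).eventually_all (l := atTop)
    (p := fun i k => ‖u (k + i) - u k‖ ≤ 1)
  exact h.mpr fun i _ => (key i).eventually_le_const one_pos

variable [InnerProductSpace ℝ F]

/-- With `δ = β‖d‖/‖w‖`, the unit vector of `w` differs from `δ` times that of `d` by `r/‖w‖`.
Comparing norms gives `|1 - δ| ≤ ‖r‖/‖w‖`, and the triangle inequality pays this error twice. -/
theorem norm_normalize_sub_normalize_le {w d r : F} {β : ℝ} (hβ : 0 ≤ β) (hw : w = r + β • d)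
    (hd : d ≠ 0) (hw0 : w ≠ 0) :
    ‖(‖w‖⁻¹ : ℝ) • w - (‖d‖⁻¹ : ℝ) • d‖ ≤ 2 * (‖r‖ / ‖w‖) := by
  have hdn : 0 < ‖d‖ := norm_pos_iff.mpr hd
  have hwn : 0 < ‖w‖ := norm_pos_iff.mpr hw0
  set δ : ℝ := β * ‖d‖ / ‖w‖
  have hδ : 0 ≤ δ := by positivity
  have hu : ‖(‖d‖⁻¹ : ℝ) • d‖ = 1 := by
    rw [norm_smul, norm_inv, norm_norm, inv_mul_cancel₀ hdn.ne']
  have hu' : ‖(‖w‖⁻¹ : ℝ) • w‖ = 1 := by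
    rw [norm_smul, norm_inv, norm_norm, inv_mul_cancel₀ hwn.ne']
  have h1 : (‖w‖⁻¹ : ℝ) • w - δ • (‖d‖⁻¹ : ℝ) • d = (‖w‖⁻¹ : ℝ) • r := by
    have : δ • (‖d‖⁻¹ : ℝ) • d = (‖w‖⁻¹ : ℝ) • β • d := by
      rw [smul_smul, smul_smul]
      congr 1
      simp only [δ]
      field_simp
    rw [this, ← smul_sub]
    congr 1
    rw [sub_eq_iff_eq_add]
    exact hw
  have h2 : ‖(‖w‖⁻¹ : ℝ) • w - δ • (‖d‖⁻¹ : ℝ) • d‖ = ‖r‖ / ‖w‖ := by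
    rw [h1, norm_smul, norm_inv, norm_norm]
    ring
  have h3 : ‖δ • (‖d‖⁻¹ : ℝ) • d - (‖d‖⁻¹ : ℝ) • d‖ = |1 - δ| := by
    have : δ • (‖d‖⁻¹ : ℝ) • d - (‖d‖⁻¹ : ℝ) • d = (δ - 1) • (‖d‖⁻¹ : ℝ) • d := by module
    rw [this, norm_smul, hu, mul_one, Real.norm_eq_abs, abs_sub_comm]
  have h4 : |1 - δ| ≤ ‖r‖ / ‖w‖ := by
    have := abs_norm_sub_norm_le ((‖w‖⁻¹ : ℝ) • w) (δ • (‖d‖⁻¹ : ℝ) • d)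
    rwa [h2, hu', norm_smul, hu, mul_one, Real.norm_eq_abs, abs_of_nonneg hδ] at this
  have h5 := norm_sub_le_norm_sub_add_norm_sub ((‖w‖⁻¹ : ℝ) • w) (δ • (‖d‖⁻¹ : ℝ) • d)
    ((‖d‖⁻¹ : ℝ) • d)
  linarith

/-- Unit vectors at distance at most 1 make an angle of at most 60°, whose cosine is at least 1/2.
-/
theorem half_norm_le_inner_normalize {d e : F} (he : e ≠ 0)
    (h : ‖(‖d‖⁻¹ : ℝ) • d - (‖e‖⁻¹ : ℝ) • e‖ ≤ 1) :
    ‖d‖ / 2 ≤ ⟪d, (‖e‖⁻¹ : ℝ) • e⟫ := by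
  rcases eq_or_ne d 0 with rfl | hd
  · simp
  have hdn : 0 < ‖d‖ := norm_pos_iff.mpr hd
  have hen : 0 < ‖e‖ := norm_pos_iff.mpr he
  set u := (‖d‖⁻¹ : ℝ) • d with hudef
  set v := (‖e‖⁻¹ : ℝ) • e
  have hu : ‖u‖ = 1 := by
    simp only [u, norm_smul, norm_inv, norm_norm, inv_mul_cancel₀ hdn.ne']
  have hv : ‖v‖ = 1 := by
    simp only [v, norm_smul, norm_inv, norm_norm, inv_mul_cancel₀ hen.ne']
  have h1 := norm_sub_sq_real u v
  rw [hu, hv] at h1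
  have h2 : d = ‖d‖ • u := by rw [hudef, smul_smul, mul_inv_cancel₀ hdn.ne', one_smul]
  have h3 : (1 : ℝ) / 2 ≤ ⟪u, v⟫ := by nlinarith [norm_nonneg (u - v)]
  have h4 : ⟪d, v⟫ = ‖d‖ * ⟪u, v⟫ := by
    conv_lhs => rw [h2]
    rw [real_inner_smul_left]
  rw [h4]
  nlinarith

/-- If the unit vectors along `d (k + i)` stay close to the one along `d k`, the lengths of the
steps add up to at most twice the distance travelled. -/
theorem sum_norm_step_le {x d : ℕ → F} {α : ℕ → ℝ} (hα : ∀ k, 0 < α k)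
    (hx : ∀ k, x (k + 1) = x k + α k • d k) {k N : ℕ} (hd : d k ≠ 0)
    (hu : ∀ i < N, ‖(‖d (k + i)‖⁻¹ : ℝ) • d (k + i) - (‖d k‖⁻¹ : ℝ) • d k‖ ≤ 1) :
    ∑ i ∈ Finset.range N, ‖x (k + i + 1) - x (k + i)‖ ≤ 2 * ‖x (k + N) - x k‖ := by
  have hdn : 0 < ‖d k‖ := norm_pos_iff.mpr hd
  set v := (‖d k‖⁻¹ : ℝ) • d k
  have hv : ‖v‖ = 1 := by
    simp only [v, norm_smul, norm_inv, norm_norm, inv_mul_cancel₀ hdn.ne']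
  have h1 : x (k + N) - x k = ∑ i ∈ Finset.range N, (x (k + i + 1) - x (k + i)) := by
    have := Finset.sum_range_sub (fun i => x (k + i)) N
    simpa [add_assoc] using this.symm
  have h2 : ∑ i ∈ Finset.range N, ‖x (k + i + 1) - x (k + i)‖ / 2 ≤ ⟪x (k + N) - x k, v⟫ := by
    rw [h1, sum_inner]
    refine Finset.sum_le_sum fun i hi => ?_
    have h := half_norm_le_inner_normalize hd (hu i (Finset.mem_range.mp hi))
    have ha := hα (k + i)
    rw [hx (k + i), add_sub_cancel_left, norm_smul, Real.norm_eq_abs, abs_of_pos ha,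
      real_inner_smul_left]
    nlinarith
  have h3 : ⟪x (k + N) - x k, v⟫ ≤ ‖x (k + N) - x k‖ := by
    simpa [hv] using real_inner_le_norm (x (k + N) - x k) v
  rw [← Finset.sum_div] at h2
  linarith

/-- The directions `d (k + 1) = r k + β k • d k` of a conjugate gradient scheme with bounded
iterates do not blow up if `β k` is at most proportional to the length of the `k`-th step
and `r k` is bounded up to a vanishing multiple of `β k • d k`. -/
theorem not_tendsto_norm_direction_atTop {x d r : ℕ → F} {α β e : ℕ → ℝ} {D C G : ℝ}
    (hα : ∀ k, 0 < α k) (hx : ∀ k, x (k + 1) = x k + α k • d k)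
    (hβ : ∀ k, 0 ≤ β k) (hd : ∀ k, d (k + 1) = r k + β k • d k)
    (hD : ∀ i j, ‖x i - x j‖ ≤ D) (hC : 0 ≤ C) (hG : 0 ≤ G)
    (hβC : ∀ᶠ k in atTop, β k ≤ C * ‖x (k + 1) - x k‖)
    (hr : ∀ᶠ k in atTop, ‖r k‖ ≤ G + e k * (β k * ‖d k‖))
    (he0 : ∀ k, 0 ≤ e k) (he : Tendsto e atTop (nhds 0)) :
    ¬ Tendsto (fun k => ‖d k‖) atTop atTop := by
  intro hdt
  have hdt1 : Tendsto (fun k => ‖d (k + 1)‖) atTop atTop := hdt.comp (tendsto_add_atTop_nat 1)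
  have he2 : ∀ᶠ k in atTop, e k ≤ 1 / 2 := he.eventually_le_const (by norm_num)
  have hpos : ∀ᶠ k in atTop, 0 < ‖d k‖ := hdt.eventually_gt_atTop 0
  have hpos1 : ∀ᶠ k in atTop, 0 < ‖d (k + 1)‖ := hdt1.eventually_gt_atTop 0
  have hu : Tendsto (fun k => ‖(‖d (k + 1)‖⁻¹ : ℝ) • d (k + 1) - (‖d k‖⁻¹ : ℝ) • d k‖)
      atTop (nhds 0) := by
    have hlim : Tendsto (fun k => 2 * (2 * (G * ‖d (k + 1)‖⁻¹) + 2 * e k)) atTop (nhds 0) := by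
      simpa using (((hdt1.inv_tendsto_atTop.const_mul G).const_mul 2).add
        (he.const_mul 2)).const_mul 2
    refine tendsto_of_tendsto_of_tendsto_of_le_of_le' tendsto_const_nhds hlim
      (Eventually.of_forall fun _ => norm_nonneg _) ?_
    filter_upwards [he2, hpos, hpos1, hr] with k h2 hp hp1 hrk
    refine (norm_normalize_sub_normalize_le (hβ k) (hd k) (norm_pos_iff.mp hp)
      (norm_pos_iff.mp hp1)).trans ?_
    have h3 : β k * ‖d k‖ ≤ ‖d (k + 1)‖ + ‖r k‖ := by
      have h4 : β k • d k = d (k + 1) - r k := by rw [hd k, add_sub_cancel_left]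
      have h5 := norm_sub_le (d (k + 1)) (r k)
      rwa [← h4, norm_smul, Real.norm_eq_abs, abs_of_nonneg (hβ k)] at h5
    -- The term `e k * ‖r k‖` is absorbed on the left, since `e k ≤ 1/2`.
    have h6 : ‖r k‖ ≤ 2 * G + 2 * e k * ‖d (k + 1)‖ := by
      have h7 := mul_le_mul_of_nonneg_left h3 (he0 k)
      nlinarith [norm_nonneg (r k)]
    have h8 : ‖r k‖ / ‖d (k + 1)‖ ≤ 2 * (G * ‖d (k + 1)‖⁻¹) + 2 * e k := by
      rw [div_le_iff₀ hp1]
      refine h6.trans_eq ?_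
      field_simp
    linarith
  -- The factor 2 covers `1 + e k`, so `b k` dominates the whole coefficient of `‖d k‖`.
  set b : ℕ → ℝ := fun k => 2 * C * ‖x (k + 1) - x k‖ with hbdef
  have hb0 : ∀ k, 0 ≤ b k := fun k => by positivity
  have hbB : ∀ k, b k ≤ 2 * C * D := fun k => by
    simp only [b]
    gcongr
    exact hD _ _
  have hrec : ∀ᶠ k in atTop, ‖d (k + 1)‖ ≤ G + b k * ‖d k‖ := by
    filter_upwards [he2, hr, hβC] with k h2 hrk hbk
    have h3 : ‖d (k + 1)‖ ≤ ‖r k‖ + β k * ‖d k‖ := by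
      have := norm_add_le (r k) (β k • d k)
      rwa [← hd k, norm_smul, Real.norm_eq_abs, abs_of_nonneg (hβ k)] at this
    have h4 : 0 ≤ β k * ‖d k‖ := mul_nonneg (hβ k) (norm_nonneg _)
    have h5 := mul_le_mul_of_nonneg_right hbk (norm_nonneg (d k))
    simp only [b]
    nlinarith
  -- Over a straight window the `b` sum to at most `2C * 2D`; this `N` makes `exp (4CD - N) ≤ 1/2`,
  -- independently of `k`.
  obtain ⟨N, hN⟩ := exists_nat_gt (max 0 (4 * C * D + Real.log 2))
  have hN0 : 0 < N := by exact_mod_cast (le_max_left _ _).trans_lt hN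
  have hN1 : 4 * C * D + Real.log 2 < N := (le_max_right _ _).trans_lt hN
  obtain ⟨K, hK⟩ := eventually_atTop.mp
    ((hrec.and hpos).and (eventually_norm_window_le_one (u := fun k => (‖d k‖⁻¹ : ℝ) • d k) hu N))
  refine not_tendsto_atTop_of_le_half (C := G * ∑ l ∈ Finset.range N, (2 * C * D) ^ l)
    (K := K) hN0 (fun k hk => ?_) hdt
  obtain ⟨⟨-, hkpos⟩, hwin⟩ := hK k hk
  have h1 := le_geom_sum_add_prod (a := fun i => ‖d (k + i)‖) (b := fun i => b (k + i)) (N := N)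
    hG (fun i => hb0 _) (fun i _ => hbB _) (fun i _ => (hK (k + i) (by omega)).1.1)
  have h2 := prod_le_exp_sum_sub_card (b := fun i => b (k + i)) (fun i => hb0 _) N
  have h3 : ∑ i ∈ Finset.range N, b (k + i) ≤ 4 * C * D := by
    have h4 := sum_norm_step_le hα hx (norm_pos_iff.mp hkpos) hwin
    have h5 := hD (k + N) k
    simp only [b, ← Finset.mul_sum]
    nlinarith
  have h6 : Real.exp (∑ i ∈ Finset.range N, b (k + i) - N) ≤ 1 / 2 := by
    calc Real.exp (∑ i ∈ Finset.range N, b (k + i) - N) ≤ Real.exp (-Real.log 2) :=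
          Real.exp_le_exp.mpr (by linarith)
      _ = 1 / 2 := by rw [Real.exp_neg, Real.exp_log two_pos, one_div]
  have h7 := mul_le_mul_of_nonneg_right (h2.trans h6) (norm_nonneg (d k))
  simp only [add_zero] at h1
  linarith

end Sequences

/-! ### The support function `lam`, the steepest direction and the PRP parameter -/

section Lam

variable {n m : ℕ} {V : Set (EuclideanSpace ℝ (Fin m))}
  {Φ : EuclideanSpace ℝ (Fin n) → EuclideanSpace ℝ (Fin m)}

theorem inner_le_lam (hV : IsCompact V) {v : EuclideanSpace ℝ (Fin m)} (hv : v ∈ V)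
    (u d : EuclideanSpace ℝ (Fin n)) : ⟪fderiv ℝ Φ u d, v⟫ ≤ lam V Φ u d :=
  le_csSup (hV.image (by fun_prop)).bddAbove ⟨v, hv, rfl⟩

theorem lam_le (hne : V.Nonempty) {u d : EuclideanSpace ℝ (Fin n)} {c : ℝ}
    (h : ∀ v ∈ V, ⟪fderiv ℝ Φ u d, v⟫ ≤ c) : lam V Φ u d ≤ c := by
  refine csSup_le (hne.image _) ?_
  rintro _ ⟨v, hv, rfl⟩
  exact h v hv

theorem lam_smul {c : ℝ} (hc : 0 ≤ c) (u d : EuclideanSpace ℝ (Fin n)) :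
    lam V Φ u (c • d) = c * lam V Φ u d := by
  rw [lam, lam, ← smul_eq_mul, ← Real.sSup_smul_of_nonneg hc]
  congr 1
  ext y
  simp [Set.mem_smul_set, real_inner_smul_left]

theorem lam_add_le (hV : IsCompact V) (hne : V.Nonempty) (u d e : EuclideanSpace ℝ (Fin n)) :
    lam V Φ u (d + e) ≤ lam V Φ u d + lam V Φ u e := by
  refine lam_le hne fun v hv => ?_
  rw [map_add, inner_add_left]
  exact add_le_add (inner_le_lam hV hv u d) (inner_le_lam hV hv u e)

theorem lam_le_lam_add (hV : IsCompact V) (hne : V.Nonempty) {R : ℝ} (hR : ∀ v ∈ V, ‖v‖ ≤ R)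
    (u w d : EuclideanSpace ℝ (Fin n)) :
    lam V Φ u d ≤ lam V Φ w d + ‖fderiv ℝ Φ u - fderiv ℝ Φ w‖ * ‖d‖ * R := by
  refine lam_le hne fun v hv => ?_
  have h1 : ⟪fderiv ℝ Φ u d, v⟫ =
      ⟪fderiv ℝ Φ w d, v⟫ + ⟪(fderiv ℝ Φ u - fderiv ℝ Φ w) d, v⟫ := by
    rw [← inner_add_left, _root_.sub_apply, add_sub_cancel]
  rw [h1]
  refine add_le_add (inner_le_lam hV hv w d) ((real_inner_le_norm _ _).trans ?_)
  exact mul_le_mul (ContinuousLinearMap.le_opNorm _ _) (hR v hv) (norm_nonneg _) (by positivity)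

theorem neg_norm_mul_le_lam (hV : IsCompact V) (hne : V.Nonempty) {R : ℝ}
    (hR : ∀ v ∈ V, ‖v‖ ≤ R) (u d : EuclideanSpace ℝ (Fin n)) :
    -(‖fderiv ℝ Φ u‖ * ‖d‖ * R) ≤ lam V Φ u d := by
  obtain ⟨v, hv⟩ := hne
  refine le_trans ?_ (inner_le_lam hV hv u d)
  refine (neg_le_neg ?_).trans (neg_le_of_abs_le (abs_real_inner_le_norm _ _))
  exact mul_le_mul (ContinuousLinearMap.le_opNorm _ _) (hR v hv) (norm_nonneg _) (by positivity)

/-- By homogeneity of `lam`, the objective along the ray `c • t` is a quadratic in `c ≥ 0`;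
minimality at `c = 1` fixes its linear coefficient. -/
theorem lam_steepest (hV : IsCompact V) (u : EuclideanSpace ℝ (Fin n)) :
    lam V Φ u (steepest V Φ u) = -‖steepest V Φ u‖ ^ 2 := by
  have h := isSteepest_steepest hV Φ u
  set t := steepest V Φ u
  have hs : ∀ c : ℝ, 0 ≤ c →
      lam V Φ u t + ‖t‖ ^ 2 / 2 ≤ c * lam V Φ u t + c ^ 2 * ‖t‖ ^ 2 / 2 := fun c hc => by
    have := h (c • t)
    rwa [lam_smul hc, norm_smul, mul_pow, Real.norm_eq_abs, sq_abs] at this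
  set A := lam V Φ u t
  set B := ‖t‖ ^ 2
  have hB : 0 ≤ B := by positivity
  have h0 := hs 0 le_rfl
  have hle : A ≤ 0 := by nlinarith
  rcases hB.eq_or_lt with hB0 | hB0
  · have := hs 2 (by norm_num)
    nlinarith
  -- The vertex of the quadratic; comparison with `c = 1` yields `(A + B)² ≤ 0`.
  · have h1 := hs (-A / B) (div_nonneg (by linarith) hB)
    have h2 : -A / B * A + (-A / B) ^ 2 * B / 2 = -A ^ 2 / (2 * B) := by field_simp; ring
    rw [h2, le_div_iff₀ (by positivity)] at h1
    have h3 : (A + B) ^ 2 ≤ 0 := by nlinarith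
    nlinarith [pow_eq_zero_iff (two_ne_zero) |>.mp (le_antisymm h3 (sq_nonneg (A + B)))]

theorem norm_steepest_le (hV : IsCompact V) (hne : V.Nonempty) {R : ℝ}
    (hR : ∀ v ∈ V, ‖v‖ ≤ R) (u : EuclideanSpace ℝ (Fin n)) :
    ‖steepest V Φ u‖ ≤ ‖fderiv ℝ Φ u‖ * R := by
  have h1 := neg_norm_mul_le_lam hV hne hR (Φ := Φ) u (steepest V Φ u)
  rw [lam_steepest hV] at h1
  have hR0 : 0 ≤ R := (norm_nonneg _).trans (hR _ hne.some_mem)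
  rcases (norm_nonneg (steepest V Φ u)).eq_or_lt with h | h
  · rw [← h]; positivity
  · nlinarith

theorem prpPlus_nonneg (y x : EuclideanSpace ℝ (Fin n)) : 0 ≤ prpPlus V Φ y x := le_max_left _ _

theorem prpPlus_le (hV : IsCompact V) (hne : V.Nonempty) {R : ℝ} (hR : ∀ v ∈ V, ‖v‖ ≤ R)
    (y x : EuclideanSpace ℝ (Fin n)) :
    prpPlus V Φ y x ≤
      ‖fderiv ℝ Φ y - fderiv ℝ Φ x‖ * ‖steepest V Φ x‖ * R / ‖steepest V Φ y‖ ^ 2 := by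
  have hR0 : 0 ≤ R := (norm_nonneg _).trans (hR _ hne.some_mem)
  refine max_le (by positivity) ?_
  rw [lam_steepest hV y, neg_neg]
  gcongr
  linarith [lam_le_lam_add hV hne hR (Φ := Φ) y x (steepest V Φ x)]

end Lam

/-! ### Descent, slopes and directions along an infinite run -/

section Run

variable {n m : ℕ} {E : ProperCone ℝ (EuclideanSpace ℝ (Fin m))}
  {V : Set (EuclideanSpace ℝ (Fin m))}
  {Φ : EuclideanSpace ℝ (Fin n) → EuclideanSpace ℝ (Fin m)}
  {ρ σ μ : ℝ} {ξ : EuclideanSpace ℝ (Fin m)}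
  {x d : ℕ → EuclideanSpace ℝ (Fin n)} {α : ℕ → ℝ}

/-- The part of the direction `d (k + 1)` along the steepest direction. -/
noncomputable def steepestPart (V : Set (EuclideanSpace ℝ (Fin m)))
    (Φ : EuclideanSpace ℝ (Fin n) → EuclideanSpace ℝ (Fin m))
    (x d : ℕ → EuclideanSpace ℝ (Fin n)) (k : ℕ) : EuclideanSpace ℝ (Fin n) :=
  (1 + prpPlus V Φ (x k) (x (k + 1)) *
    (|lam V Φ (x (k + 1)) (d k)| / ‖steepest V Φ (x (k + 1))‖ ^ 2)) • steepest V Φ (x (k + 1))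

theorem IsInfiniteRun.dir_succ_eq (h : IsInfiniteRun E V Φ ρ σ μ ξ x d α) (hV : IsCompact V)
    (k : ℕ) : d (k + 1) =
      steepestPart V Φ x d k + prpPlus V Φ (x k) (x (k + 1)) • d k := by
  rw [h.dir_succ k, lam_steepest hV, steepestPart, div_neg, mul_neg, neg_smul, add_smul, one_smul]
  abel

theorem IsInfiniteRun.nonempty (h : IsInfiniteRun E V Φ ρ σ μ ξ x d α) : V.Nonempty := by
  by_contra hV
  rw [Set.not_nonempty_iff_eq_empty] at hV
  subst hV
  have h1 := lam_steepest (Φ := Φ) isCompact_empty (x 0)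
  refine h.1 0 ?_
  -- For empty `V` the supremum is the default value 0, so the steepest direction vanishes and the
  -- run would stop.
  simpa [lam] using h1

theorem IsInfiniteRun.norm_steepest_pos (h : IsInfiniteRun E V Φ ρ σ μ ξ x d α) (k : ℕ) :
    0 < ‖steepest V Φ (x k)‖ :=
  norm_pos_iff.mpr (h.1 k)

/-- The third term of the direction contributes `-β|λ(x (k+1), d k)|`, which cancels whatever `β • d
k` adds, so descent holds for any `β ≥ 0`. -/
theorem IsInfiniteRun.lam_le (h : IsInfiniteRun E V Φ ρ σ μ ξ x d α) (hV : IsCompact V) (k : ℕ) :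
    lam V Φ (x k) (d k) ≤ -‖steepest V Φ (x k)‖ ^ 2 := by
  cases k with
  | zero => rw [h.dir_zero, lam_steepest hV]
  | succ k =>
    have hpos := h.norm_steepest_pos (k + 1)
    have hβ := prpPlus_nonneg (V := V) (Φ := Φ) (x k) (x (k + 1))
    have h1 := lam_add_le hV h.nonempty (Φ := Φ) (x (k + 1)) (steepestPart V Φ x d k)
      (prpPlus V Φ (x k) (x (k + 1)) • d k)
    rw [← h.dir_succ_eq hV k, steepestPart, lam_smul (by positivity), lam_smul hβ,
      lam_steepest hV] at h1
    have h2 := mul_le_mul_of_nonneg_left (le_abs_self (lam V Φ (x (k + 1)) (d k))) hβ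
    refine h1.trans ?_
    have h3 : (1 + prpPlus V Φ (x k) (x (k + 1)) *
        (|lam V Φ (x (k + 1)) (d k)| / ‖steepest V Φ (x (k + 1))‖ ^ 2)) *
        -‖steepest V Φ (x (k + 1))‖ ^ 2 = -‖steepest V Φ (x (k + 1))‖ ^ 2 -
        prpPlus V Φ (x k) (x (k + 1)) * |lam V Φ (x (k + 1)) (d k)| := by
      field_simp
      ring
    rw [h3]
    linarith

theorem IsInfiniteRun.lam_neg (h : IsInfiniteRun E V Φ ρ σ μ ξ x d α) (hV : IsCompact V) (k : ℕ) :
    lam V Φ (x k) (d k) < 0 :=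
  (h.lam_le hV k).trans_lt (neg_lt_zero.mpr (pow_pos (h.norm_steepest_pos k) 2))

theorem IsInfiniteRun.dir_ne_zero (h : IsInfiniteRun E V Φ ρ σ μ ξ x d α) (hV : IsCompact V)
    (k : ℕ) : d k ≠ 0 := by
  intro h0
  have h1 := h.lam_neg hV k
  have h2 := lam_smul (V := V) (Φ := Φ) le_rfl (x k) 0
  rw [zero_smul, zero_mul] at h2
  rw [h0, h2] at h1
  exact lt_irrefl _ h1

theorem IsInfiniteRun.mem_levelSet (h : IsInfiniteRun E V Φ ρ σ μ ξ x d α) (hV : IsCompact V)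
    (hρ : 0 ≤ ρ) (hξ : ξ ∈ E) (k : ℕ) : coneLE E (Φ (x k)) (Φ (x 0)) := by
  induction k with
  | zero => simp [coneLE]
  | succ k ih =>
    have h1 := (h.line_search k).decrease
    rw [← h.step k] at h1
    have hc : 0 ≤ -(ρ * α k * lam V Φ (x k) (d k)) := by
      have := mul_nonneg (mul_nonneg hρ (h.line_search k).step_pos.le)
        (neg_nonneg.mpr (h.lam_neg hV k).le)
      linarith
    have h2 := E.add_mem (E.add_mem ih h1) (E.smul_mem hξ hc)
    have h3 : Φ (x 0) - Φ (x (k + 1)) = Φ (x 0) - Φ (x k) +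
        (Φ (x k) + (ρ * α k * lam V Φ (x k) (d k)) • ξ - Φ (x (k + 1))) +
        -(ρ * α k * lam V Φ (x k) (d k)) • ξ := by module
    rw [coneLE, h3]
    exact h2

theorem IsInfiniteRun.abs_lam_succ_le (h : IsInfiniteRun E V Φ ρ σ μ ξ x d α) (hV : IsCompact V)
    (hσ : σ ≤ 1) (hμ : 0 ≤ μ) (k : ℕ) :
    |lam V Φ (x (k + 1)) (d k)| ≤ (μ + 1) * -lam V Φ (x k) (d k) := by
  have h1 := (h.line_search k).curvature_upper
  have h2 := (h.line_search k).curvature_lower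
  rw [← h.step k] at h1 h2
  have h3 := h.lam_neg hV k
  rw [abs_le]
  constructor <;> nlinarith

/-- The part of Zoutendijk's condition that is needed: the normalized slopes tend to `0`. -/
theorem IsInfiniteRun.tendsto_slope (h : IsInfiniteRun E V Φ ρ σ μ ξ x d α) (hV : IsCompact V)
    (hρ : 0 < ρ) (hσ : σ < 1) {v : EuclideanSpace ℝ (Fin m)} (hv : v ∈ ProperCone.innerDual
      (E : Set (EuclideanSpace ℝ (Fin m)))) (hξv : 0 < ⟪ξ, v⟫)
    {c : ℝ} (hc : ∀ k, c ≤ ⟪Φ (x k), v⟫) {M : ℝ}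
    (hM : ∀ k, lam V Φ (x (k + 1)) (d k) ≤ lam V Φ (x k) (d k) + M * (α k * ‖d k‖) * ‖d k‖) :
    Tendsto (fun k => -lam V Φ (x k) (d k) / ‖d k‖) atTop (nhds 0) := by
  -- Pairing the vector decrease with a single `v` gives a scalar potential `⟪Φ (x k), v⟫` that is
  -- bounded below.
  have hdec : ∀ k, (ρ * ⟪ξ, v⟫) * (α k * -lam V Φ (x k) (d k)) ≤
      ⟪Φ (x k), v⟫ - ⟪Φ (x (k + 1)), v⟫ := fun k => by
    have h1 := (h.line_search k).decrease
    rw [← h.step k] at h1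
    have h2 := ProperCone.mem_innerDual.mp hv h1
    rw [inner_sub_left, inner_add_left, real_inner_smul_left] at h2
    linarith
  have hpos : ∀ k, 0 < α k * -lam V Φ (x k) (d k) := fun k =>
    mul_pos (h.line_search k).step_pos (neg_pos.mpr (h.lam_neg hV k))
  have hρξ : 0 < ρ * ⟪ξ, v⟫ := mul_pos hρ hξv
  have hanti : Antitone fun k => ⟪Φ (x k), v⟫ := antitone_nat_of_succ_le fun k => by
    linarith [hdec k, mul_pos hρξ (hpos k)]
  have h0 := tendsto_sub_succ_of_le hanti hc
  have hK : Tendsto (fun k => |M| / ((1 - σ) * (ρ * ⟪ξ, v⟫)) *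
      (⟪Φ (x k), v⟫ - ⟪Φ (x (k + 1)), v⟫)) atTop (nhds 0) := by
    simpa using h0.const_mul (|M| / ((1 - σ) * (ρ * ⟪ξ, v⟫)))
  have hsq : Tendsto (fun k => (-lam V Φ (x k) (d k) / ‖d k‖) ^ 2) atTop (nhds 0) := by
    refine squeeze_zero (fun _ => sq_nonneg _) (fun k => ?_) hK
    have hd : 0 < ‖d k‖ := norm_pos_iff.mpr (h.dir_ne_zero hV k)
    have h1 := (h.line_search k).curvature_lower
    rw [← h.step k] at h1
    have ha := (h.line_search k).step_pos
    set l := -lam V Φ (x k) (d k) with hl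
    have hl0 : 0 < l := neg_pos.mpr (h.lam_neg hV k)
    -- The curvature condition bounds the step from below; combined with `hdec`, the squared slope
    -- is at most a constant times the drop of the potential.
    have h2 : (1 - σ) * l ≤ |M| * α k * ‖d k‖ ^ 2 := by
      have h3 : M * (α k * ‖d k‖) * ‖d k‖ ≤ |M| * α k * ‖d k‖ ^ 2 := by
        have := mul_le_mul_of_nonneg_right (le_abs_self M)
          (by positivity : 0 ≤ α k * ‖d k‖ ^ 2)
        linarith
      have := hM k
      nlinarith
    have h1σ : 0 < 1 - σ := by linarith
    rw [div_pow, div_mul_eq_mul_div, div_le_div_iff₀ (by positivity) (by positivity)]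
    have h4 := mul_le_mul_of_nonneg_right h2 (mul_pos hl0 hρξ).le
    have h5 := mul_le_mul_of_nonneg_left (hdec k) (by positivity : 0 ≤ |M| * ‖d k‖ ^ 2)
    linarith
  have := hsq.sqrt
  simp only [Real.sqrt_zero] at this
  refine this.congr fun k => Real.sqrt_sq ?_
  exact div_nonneg (neg_nonneg.mpr (h.lam_neg hV k).le) (norm_nonneg _)

theorem IsInfiniteRun.norm_steepestPart_le (h : IsInfiniteRun E V Φ ρ σ μ ξ x d α)
    (hV : IsCompact V) (hσ : σ ≤ 1) (hμ : 0 ≤ μ) {k : ℕ} {γ G : ℝ} (hγ : 0 < γ)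
    (hγk : γ ≤ ‖steepest V Φ (x (k + 1))‖) (hGk : ‖steepest V Φ (x (k + 1))‖ ≤ G) :
    ‖steepestPart V Φ x d k‖ ≤ G + (μ + 1) / γ * (-lam V Φ (x k) (d k) / ‖d k‖) *
      (prpPlus V Φ (x k) (x (k + 1)) * ‖d k‖) := by
  have hpos := h.norm_steepest_pos (k + 1)
  have hβ := prpPlus_nonneg (V := V) (Φ := Φ) (x k) (x (k + 1))
  have hd : 0 < ‖d k‖ := norm_pos_iff.mpr (h.dir_ne_zero hV k)
  have h1 := h.abs_lam_succ_le hV hσ hμ k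
  have hl0 : 0 < -lam V Φ (x k) (d k) := neg_pos.mpr (h.lam_neg hV k)
  rw [steepestPart, norm_smul, Real.norm_eq_abs, abs_of_nonneg (by positivity)]
  calc _ = ‖steepest V Φ (x (k + 1))‖ + prpPlus V Φ (x k) (x (k + 1)) *
        (|lam V Φ (x (k + 1)) (d k)| / ‖steepest V Φ (x (k + 1))‖) := by
        field_simp
    _ ≤ G + prpPlus V Φ (x k) (x (k + 1)) * ((μ + 1) * -lam V Φ (x k) (d k) / γ) := by
        gcongr
    _ = _ := by field_simp

/-- Along an infinite run with bounded level set, the steepest directions are not bounded away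
from `0`. -/
theorem IsInfiniteRun.not_eventually_le_norm_steepest (h : IsInfiniteRun E V Φ ρ σ μ ξ x d α)
    (hV : IsDualBase E V) (hΦ : ContDiff ℝ 1 Φ) (hρ : 0 < ρ) (hσ : σ < 1) (hμ : 0 ≤ μ)
    (hξE : ξ ∈ E) (hξ : ∀ v ∈ V, 0 < ⟪ξ, v⟫)
    (hΔ : Bornology.IsBounded {u | coneLE E (Φ u) (Φ (x 0))}) {L : ℝ≥0}
    (hLip : LipschitzOnWith L (fderiv ℝ Φ) {u | coneLE E (Φ u) (Φ (x 0))})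
    {γ : ℝ} (hγ : 0 < γ) : ¬ ∀ᶠ k in atTop, γ ≤ ‖steepest V Φ (x k)‖ := by
  intro hev
  have hVc := hV.isCompact
  have hne := h.nonempty
  obtain ⟨R, hR⟩ := hVc.isBounded.exists_norm_le
  have hR0 : 0 ≤ R := (norm_nonneg _).trans (hR _ hne.some_mem)
  have hmem : ∀ k, x k ∈ {u | coneLE E (Φ u) (Φ (x 0))} := fun k => h.mem_levelSet hVc hρ.le hξE k
  have hcpt := hΔ.isCompact_closure
  obtain ⟨D, hD⟩ := Metric.isBounded_iff.mp hΔ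
  have hxD : ∀ i j, ‖x i - x j‖ ≤ D := fun i j => by
    rw [← dist_eq_norm]
    exact hD (hmem i) (hmem j)
  obtain ⟨J, hJ⟩ := hcpt.exists_bound_of_continuousOn
    (hΦ.continuous_fderiv one_ne_zero).continuousOn
  have hG : ∀ k, ‖steepest V Φ (x k)‖ ≤ J * R := fun k =>
    (norm_steepest_le hVc hne hR (x k)).trans
      (mul_le_mul_of_nonneg_right (hJ _ (subset_closure (hmem k))) hR0)
  have hG0 : 0 ≤ J * R := (norm_nonneg _).trans (hG 0)
  obtain ⟨v, hv⟩ := hne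
  obtain ⟨B, hB⟩ := hcpt.exists_bound_of_continuousOn (f := fun u => ⟪Φ u, v⟫)
    (hΦ.continuous.inner continuous_const).continuousOn
  have hlip : ∀ i j, ‖fderiv ℝ Φ (x i) - fderiv ℝ Φ (x j)‖ ≤ L * ‖x i - x j‖ := fun i j => by
    have := hLip.dist_le_mul _ (hmem i) _ (hmem j)
    rwa [dist_eq_norm, dist_eq_norm] at this
  have hslope := h.tendsto_slope hVc hρ hσ (hV.subset_dual hv) (hξ v hv) (c := -B)
    (fun k => neg_le_of_abs_le (hB _ (subset_closure (hmem k)))) (M := L * R) (fun k => by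
      refine (lam_le_lam_add hVc ⟨v, hv⟩ hR _ (x k) _).trans ?_
      have h1 := hlip (k + 1) k
      have h2 : ‖x (k + 1) - x k‖ = α k * ‖d k‖ := by
        rw [h.step k, add_sub_cancel_left, norm_smul, Real.norm_eq_abs,
          abs_of_pos (h.line_search k).step_pos]
      rw [h2] at h1
      have h3 := mul_le_mul_of_nonneg_right h1 (mul_nonneg (norm_nonneg (d k)) hR0)
      linarith)
  have hslope0 : ∀ k, 0 ≤ -lam V Φ (x k) (d k) / ‖d k‖ := fun k =>
    div_nonneg (neg_nonneg.mpr (h.lam_neg hVc k).le) (norm_nonneg _)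
  have hdpos : ∀ k, 0 < ‖d k‖ := fun k => norm_pos_iff.mpr (h.dir_ne_zero hVc k)
  have hslopepos : ∀ k, 0 < -lam V Φ (x k) (d k) / ‖d k‖ := fun k =>
    div_pos (neg_pos.mpr (h.lam_neg hVc k)) (hdpos k)
  have hev1 : ∀ᶠ k in atTop, γ ≤ ‖steepest V Φ (x (k + 1))‖ :=
    (tendsto_add_atTop_nat 1).eventually hev
  -- Since `-λ(x k, d k) ≥ γ²`, the norm `‖d k‖` is at least `γ²` over the slope, which tends to 0
  -- from above.
  have hdtop : Tendsto (fun k => ‖d k‖) atTop atTop := by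
    have h1 : Tendsto (fun k => (-lam V Φ (x k) (d k) / ‖d k‖)⁻¹) atTop atTop :=
      (tendsto_nhdsWithin_iff.mpr ⟨hslope, Eventually.of_forall hslopepos⟩).inv_tendsto_nhdsGT_zero
    refine tendsto_atTop_mono' _ ?_ (h1.const_mul_atTop (by positivity : 0 < γ ^ 2))
    filter_upwards [hev] with k hk
    have h2 := h.lam_le hVc k
    have h3 : γ ^ 2 ≤ ‖steepest V Φ (x k)‖ ^ 2 := by gcongr
    have h4 : 0 < -lam V Φ (x k) (d k) := neg_pos.mpr (h.lam_neg hVc k)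
    rw [inv_div, mul_div_assoc', div_le_iff₀ h4, mul_comm]
    exact mul_le_mul_of_nonneg_left (by linarith) (norm_nonneg _)
  refine not_tendsto_norm_direction_atTop (r := steepestPart V Φ x d)
    (β := fun k => prpPlus V Φ (x k) (x (k + 1)))
    (e := fun k => (μ + 1) / γ * (-lam V Φ (x k) (d k) / ‖d k‖))
    (D := D) (C := L * (J * R) * R / γ ^ 2) (G := J * R)
    (fun k => (h.line_search k).step_pos) h.step (fun k => prpPlus_nonneg _ _)
    (h.dir_succ_eq hVc) hxD (by positivity) hG0 ?_ ?_
    (fun k => mul_nonneg (by positivity) (hslope0 k)) (by simpa using hslope.const_mul _) hdtop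
  · filter_upwards [hev] with k hk
    refine (prpPlus_le hVc ⟨v, hv⟩ hR _ _).trans ?_
    calc _ ≤ (L * ‖x k - x (k + 1)‖) * (J * R) * R / γ ^ 2 := by
          gcongr
          · exact hlip _ _
          · exact hG _
      _ = _ := by rw [norm_sub_rev]; ring
  · filter_upwards [hev1] with k hk
    exact h.norm_steepestPart_le hVc hσ.le hμ hγ hk (hG _)

end Run

end VecOpt

theorem theorem4p1 {n m : ℕ}
    (E : ProperCone ℝ (EuclideanSpace ℝ (Fin m))) (hE : VecOpt.IsOrderingCone E)
    (V : Set (EuclideanSpace ℝ (Fin m))) (hV : VecOpt.IsDualBase E V)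
    (Φ : EuclideanSpace ℝ (Fin n) → EuclideanSpace ℝ (Fin m)) (hΦ : ContDiff ℝ 1 Φ)
    (ρ σ μ : ℝ) (hρ : 0 < ρ) (hρσ : ρ < σ) (hσ : σ < 1) (hμ : 0 < μ)
    (ξ : EuclideanSpace ℝ (Fin m)) (hξE : ξ ∈ E) (hξ : ∀ v ∈ V, 0 < ⟪ξ, v⟫ ∧ ⟪ξ, v⟫ ≤ 1)
    (x d : ℕ → EuclideanSpace ℝ (Fin n)) (α : ℕ → ℝ)
    (hVfin : V.Finite)
    (hΔ : Bornology.IsBounded {u | VecOpt.coneLE E (Φ u) (Φ (x 0))})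
    (hLip : ∃ (L : ℝ≥0) (Ω : Set (EuclideanSpace ℝ (Fin n))), IsOpen Ω ∧
      {u | VecOpt.coneLE E (Φ u) (Φ (x 0))} ⊆ Ω ∧ LipschitzOnWith L (fderiv ℝ Φ) Ω)
    (hrun : VecOpt.IsInfiniteRun E V Φ ρ σ μ ξ x d α) :
    liminf (fun k => ‖VecOpt.steepest V Φ (x k)‖ₑ) atTop = 0 := by
  -- In `ℝ≥0∞` the liminf carries no boundedness side condition; if it is nonzero, a finite positive
  -- `c` below it is an eventual lower bound.
  obtain ⟨L, Ω, -, hΩ, hL⟩ := hLip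
  by_contra hne
  obtain ⟨c, hc0, hc⟩ := exists_between (pos_iff_ne_zero.mpr hne)
  have hctop : c ≠ ⊤ := (hc.trans_le le_top).ne
  refine hrun.not_eventually_le_norm_steepest hV hΦ hρ hσ hμ.le hξE (fun v hv => (hξ v hv).1) hΔ
    (hL.mono hΩ) (ENNReal.toReal_pos hc0.ne' hctop) ?_
  filter_upwards [eventually_lt_of_lt_liminf hc] with k hk
  rw [← toReal_enorm]
  exact ENNReal.toReal_mono enorm_ne_top hk.le
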